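/- Let $K$ be a field, $R=K[x_1,\dots,x_n]$, and let $I\subseteq R$ be a monomial ideal with (finite) minimal set of monomial generators $G(I)$. The least common multiple of the empty set is $1$. Let $\prec$ be a strict total order on $G(I)$. For $F=\{m_{i_1}\prec\dots\prec m_{i_t}\}\subseteq G(I)$ the symbol $u(F)$ is $L$-admissible of dimension $t$ if no $q\in G(I)$ with $q\prec m_{i_h}$, $h<t$, divides $\mathrm{lcm}(m_{i_h},\dots,m_{i_t})$. The Lyubeznik resolution of $R/I$ with respect to $\prec$ is $\cdots\to L^2\to L^1\to L^0=R\to R/I\to 0$, where $L^t$ is the free $R$-module on the $L$-admissible symbols of dimension $t$ and $$\partial\, u(F)=\sum_{j=1}^{t}(-1)^{j+1}\frac{\mathrm{lcm}(F)}{\mathrm{lcm}(F\setminus\{m_{i_j}\})}\,u(F\setminus\{m_{i_j}\}).$$ It is a minimal free resolution if it is exact and $\partial(L^{t})\subseteq (x_1,\dots,x_n)L^{t-1}$ for all $t\ge 1$. The ideal $I$ is a Lyubeznik ideal if for some total order on $G(I)$ the Lyubeznik resolution of $R/I$ is a minimal free resolution. A set $C\subseteq G(I)$ is a cover of $u\in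 C$ if $u\mid \mathrm{lcm}(C\setminus\{u\})$, and an $E$-minimal cover of $u$ if moreover no proper subset of $C$ is a cover of $u$. Let $\mathcal C_E(I)$ be the family of all sets that are an $E$-minimal cover of some $u\in G(I)$, and let $\mathcal C_{\min}(I)$ be the family of the covers (of some element) that contain no other cover (of any element) as a proper subset. A nonempty set $D\subseteq G(I)$ is broken under $\prec$ if some $u\in G(I)$ divides $\mathrm{lcm}(D)$ and satisfies $u\prec \min(D)$. A set is preserved under $\prec$ if none of its subsets is broken. A family $\mathcal C$ of subsets of $G(I)$ is Lyubeznik under $\prec$ (a Lyubeznik clutter) if no member of $\mathcal C$ is preserved. Put $$ObsL(\mathcal C,\prec)=\max\{|A| : A\in\mathcal C,\ A\text{ is preserved under }\prec\}$$ ($0$ if there is no such $A$), let $TObsL(\mathcal C)$ be the minimum of $ObsL(\mathcal C,\prec)$ over all total orders $\prec$ on $G(I)$, and put $TObsL(I)=TObsL(\mathcal C_E(I))$. **Theorem.** 1. $I$ is a Lyubeznik ideal if and only if $TObsL(I)=0$. 2. $I$ is a Lyubeznik ideal if and only if $\mathcal C_E(I)$ is Lyubeznik under some total order on $G(I)$.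 More precisely, for every total order $\prec$ on $G(I)$, the Lyubeznik resolution of $R/I$ with respect to $\prec$ is a minimal free resolution if and only if $\mathcal C_E(I)$ is Lyubeznik under $\prec$. 3. No member of $\mathcal C_{\min}(I)$ contains another one, and 1 and 2 also hold with $\mathcal C_{\min}(I)$ in place of $\mathcal C_E(I)$ and $TObsL(\mathcal C_{\min}(I))$ in place of $TObsL(I)$. -/

import Mathlib

/-! Monomials of `K[x₁, …, xₙ]` are represented by their exponent vectors `Fin n →₀ ℕ`; divisibility
of monomials is the pointwise order `≤` and the least common multiple is the supremum. -/

noncomputable section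

namespace Lyubeznik

open MvPolynomial

variable {K : Type*} [Field K] {n : ℕ}

/-- An ideal generated by monomials. -/
def IsMonomialIdeal (I : Ideal (MvPolynomial (Fin n) K)) : Prop :=
  ∃ S : Set (Fin n →₀ ℕ), I = Ideal.span ((fun a => monomial a (1 : K)) '' S)

/-- The set `G(I)` of minimal monomial generators of a monomial ideal: the monomials in `I` that are
minimal for divisibility among the monomials in `I`. -/
def gens (I : Ideal (MvPolynomial (Fin n) K)) : Set (Fin n →₀ ℕ) :=
  {a | Minimal (fun b => monomial b (1 : K) ∈ I) a}

/-- `G(I)` is finite. -/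
instance gens_finite (I : Ideal (MvPolynomial (Fin n) K)) : Finite (gens I) :=
  Set.Finite.to_subtype ((setOfPred_minimal_antichain _).finite_of_wellQuasiOrdered wellQuasiOrdered_le)

/-! ### Covers and preserved sets -/

/-- The least common multiple (multidegree) of a set of generators; it is `1` for the empty set. -/
def lcm {G : Set (Fin n →₀ ℕ)} (A : Finset G) : Fin n →₀ ℕ :=
  A.sup fun u => (u : Fin n →₀ ℕ)

open scoped Classical in
/-- `C` is a cover of `u`: `u ∈ C` and `u` divides `lcm (C - {u})`. -/
def IsCoverOf {G : Set (Fin n →₀ ℕ)} (C : Finset G) (u : G) : Prop :=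
  u ∈ C ∧ (u : Fin n →₀ ℕ) ≤ lcm (C.erase u)

/-- `C` is an `E`-minimal cover of `u`: no proper subset of `C` covers `u`. -/
def IsEMinimalCoverOf {G : Set (Fin n →₀ ℕ)} (C : Finset G) (u : G) : Prop :=
  IsCoverOf C u ∧ ∀ D, D ⊂ C → ¬ IsCoverOf D u

/-- The family of all `E`-minimal covers (of some element). -/
def eMinimalCovers (G : Set (Fin n →₀ ℕ)) : Set (Finset G) :=
  {C | ∃ u, IsEMinimalCoverOf C u}

/-- The family of the inclusion-minimal covers: those covers no proper subset of which is a cover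
(of any element). -/
def minimalCovers (G : Set (Fin n →₀ ℕ)) : Set (Finset G) :=
  {C | Minimal (fun D => ∃ u, IsCoverOf D u) C}

/-- `D` is broken under the total order `r`: some `u` divides `lcm D` and strictly precedes the
least element of `D`, that is, strictly precedes all elements of the nonempty set `D`. -/
def IsBroken {G : Set (Fin n →₀ ℕ)} (r : G → G → Prop) (D : Finset G) : Prop :=
  D.Nonempty ∧ ∃ u : G, (u : Fin n →₀ ℕ) ≤ lcm D ∧ ∀ d ∈ D, r u d

/-- A set is preserved if none of its subsets is broken. -/
def IsPreserved {G : Set (Fin n →₀ ℕ)} (r : G → G → Prop) (E : Finset G) : Prop :=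
  ∀ D, D ⊆ E → ¬ IsBroken r D

/-- A family of edges is Lyubeznik for the order `r` if no edge is preserved. -/
def IsLyubeznikClutter {G : Set (Fin n →₀ ℕ)} (r : G → G → Prop) (𝒞 : Set (Finset G)) : Prop :=
  ∀ A ∈ 𝒞, ¬ IsPreserved r A

/-- The Lyubeznik obstruction of a family `𝒞` with respect to `r`: the maximal size of a preserved
member of `𝒞`, and `0` if there is none (`sSup ∅ = 0`). For finite `G` the sizes are bounded, so that
the supremum is a maximum. -/
def obs {G : Set (Fin n →₀ ℕ)} (r : G → G → Prop) (𝒞 : Set (Finset G)) : ℕ :=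
  sSup {k | ∃ A ∈ 𝒞, IsPreserved r A ∧ A.card = k}

/-- The total Lyubeznik obstruction of a family `𝒞`: the minimum of the obstructions over all strict
total orders on the vertex set. Such orders exist, so that the infimum is a minimum. -/
def totalObs {G : Set (Fin n →₀ ℕ)} (𝒞 : Set (Finset G)) : ℕ :=
  sInf {k | ∃ r : G → G → Prop, IsStrictTotalOrder G r ∧ obs r 𝒞 = k}

/-- The total Lyubeznik obstruction `TObsL(I)` of an ideal. -/
def TObsL (I : Ideal (MvPolynomial (Fin n) K)) : ℕ :=
  totalObs (eMinimalCovers (gens I))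

/-! ### The Lyubeznik resolution -/

open scoped Classical in
/-- The symbol `u(i₁; …; iₜ)` given by the elements `m_{i₁} ≺ … ≺ m_{iₜ}` of `F` is `L`-admissible:
`m_q` does not divide `lcm(m_{iₕ}, …, m_{iₜ})` for all `h < t` and `q < iₕ`. Here `a = m_{iₕ}`, and
`h < t` says that `a` is not the last element of `F`. -/
def IsAdmissible {G : Set (Fin n →₀ ℕ)} (r : G → G → Prop) (F : Finset G) : Prop :=
  ∀ a ∈ F, (∃ b ∈ F, r a b) →
    ∀ q : G, r q a → ¬ (q : Fin n →₀ ℕ) ≤ lcm (F.filter fun c => ¬ r c a)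

/-- The `L`-admissible symbols of dimension `t`. -/
def Symbols {G : Set (Fin n →₀ ℕ)} (r : G → G → Prop) (t : ℕ) : Type :=
  {F : Finset G // F.card = t ∧ IsAdmissible r F}

open scoped Classical in
theorem IsAdmissible.erase {G : Set (Fin n →₀ ℕ)} {r : G → G → Prop} {F : Finset G}
    (h : IsAdmissible r F) (a : G) : IsAdmissible r (F.erase a) := by
  rintro c hc ⟨b, hb, hcb⟩ q hq hle
  refine h c (Finset.mem_of_mem_erase hc) ⟨b, Finset.mem_of_mem_erase hb, hcb⟩ q hq (hle.trans ?_)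
  exact Finset.sup_mono (Finset.filter_subset_filter _ (Finset.erase_subset _ _))

open scoped Classical in
/-- The symbol obtained by deleting an element. -/
def Symbols.face {G : Set (Fin n →₀ ℕ)} {r : G → G → Prop} {t : ℕ} (F : Symbols r (t + 1))
    (a : G) (ha : a ∈ F.1) : Symbols r t :=
  ⟨F.1.erase a, by rw [Finset.card_erase_of_mem ha, F.2.1]; rfl, F.2.2.erase a⟩

/-- The empty symbol, the basis of `L⁰ = R`. -/
def Symbols.empty {G : Set (Fin n →₀ ℕ)} (r : G → G → Prop) : Symbols r 0 :=
  ⟨∅, Finset.card_empty, fun a ha => absurd ha (Finset.notMem_empty a)⟩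

variable (K) in
/-- The free module `Lᵗ` on the `L`-admissible symbols of dimension `t`. -/
abbrev L {G : Set (Fin n →₀ ℕ)} (r : G → G → Prop) (t : ℕ) : Type _ :=
  Symbols r t →₀ MvPolynomial (Fin n) K

open scoped Classical in
variable (K) in
/-- The differential `L^{t+1} → Lᵗ`, with
`∂ u(F) = ∑_{a ∈ F} ± (lcm F / lcm (F - {a})) u(F - {a})`, where the sign is `(-1)^{j+1}` for the
`j`-th element `a` of `F`, that is, `-1` to the number of elements of `F` preceding `a`. -/
def differential {G : Set (Fin n →₀ ℕ)} (r : G → G → Prop) (t : ℕ) :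
    L K r (t + 1) →ₗ[MvPolynomial (Fin n) K] L K r t :=
  Finsupp.linearCombination (MvPolynomial (Fin n) K) fun F : Symbols r (t + 1) =>
    ∑ a : F.1, Finsupp.single (F.face a.1 a.2)
      ((-1) ^ (F.1.filter fun c => r c a.1).card *
        monomial (lcm F.1 - lcm (F.1.erase a.1)) (1 : K))

/-- The augmentation `L⁰ = R → R/I`. -/
def augmentation (I : Ideal (MvPolynomial (Fin n) K)) (r : gens I → gens I → Prop) :
    L K r 0 →ₗ[MvPolynomial (Fin n) K] MvPolynomial (Fin n) K ⧸ I :=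
  Finsupp.linearCombination (MvPolynomial (Fin n) K) fun _ => (1 : MvPolynomial (Fin n) K ⧸ I)

/-- `⋯ → P 2 → P 1 → P 0 → M → 0` is a minimal free resolution of `M` over `K[x₁, …, xₙ]`: the
modules are free, the sequence is exact, and the differentials have image in
`(x₁, …, xₙ) • P t`. -/
structure IsMinimalFreeResolution {M : Type*} [AddCommGroup M] [Module (MvPolynomial (Fin n) K) M]
    (P : ℕ → Type*) [∀ t, AddCommGroup (P t)] [∀ t, Module (MvPolynomial (Fin n) K) (P t)]
    (d : ∀ t, P (t + 1) →ₗ[MvPolynomial (Fin n) K] P t)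
    (ε : P 0 →ₗ[MvPolynomial (Fin n) K] M) : Prop where
  free : ∀ t, Module.Free (MvPolynomial (Fin n) K) (P t)
  finite : ∀ t, Module.Finite (MvPolynomial (Fin n) K) (P t)
  surjective : Function.Surjective ε
  exact_zero : Function.Exact (d 0) ε
  exact_succ : ∀ t, Function.Exact (d (t + 1)) (d t)
  minimal : ∀ t, LinearMap.range (d t) ≤
    Ideal.span (Set.range (X : Fin n → MvPolynomial (Fin n) K)) •
      (⊤ : Submodule (MvPolynomial (Fin n) K) (P t))

/-- The Lyubeznik resolution of `R/I` for the order `r` on `G(I)` is a minimal free resolution. -/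
def HasMinimalResolution (I : Ideal (MvPolynomial (Fin n) K)) (r : gens I → gens I → Prop) : Prop :=
  IsMinimalFreeResolution (fun t => L K r t) (differential K r) (augmentation I r)

/-- `I` is a Lyubeznik ideal: for some total order on `G(I)` the Lyubeznik resolution of `R/I` is a
minimal free resolution. -/
def IsLyubeznikIdeal (I : Ideal (MvPolynomial (Fin n) K)) : Prop :=
  ∃ r : gens I → gens I → Prop, IsStrictTotalOrder (gens I) r ∧ HasMinimalResolution I r

end Lyubeznik

end

noncomputable section

namespace Lyubeznik

open MvPolynomial

/-! ### Preserved sets, covers and obstruction numbers -/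

section Combinatorics

variable {n : ℕ} {G : Set (Fin n →₀ ℕ)} {r : G → G → Prop}

/-! The Lyubeznik complex is exact for every order, so only minimality is at stake. In multidegree
`d`, coning over the first generator `q` dividing `d` is a contracting homotopy: adjoining `q` keeps
a symbol admissible (`IsAdmissible.insert`, `homotopy`). Even `∂ ∂ = 0` follows from this homotopy,
since its image contains every symbol of dimension at least 2.

The coefficient of `F \ {a}` in `∂ u(F)` is a unit exactly when `F` covers `a`
(`lcm_sub_lcm_erase_eq_zero_iff`). Admissible symbols are the preserved sets because `G(I)` is an
antichain, so the resolution is minimal iff no cover is preserved (`hasMinimalResolution_iff`).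
Every cover contains an `E`-minimal one and an inclusion-minimal one, and subsets of preserved sets
are preserved; hence either family suffices to test this. Members of both families are nonempty, so
obstruction 0 means that no member is preserved. -/

theorem le_lcm {A : Finset G} {u : G} (hu : u ∈ A) : (u : Fin n →₀ ℕ) ≤ lcm A :=
  Finset.le_sup (f := fun u : G => (u : Fin n →₀ ℕ)) hu

theorem lcm_mono {A B : Finset G} (h : A ⊆ B) : lcm A ≤ lcm B :=
  Finset.sup_mono h

theorem lcm_le {A : Finset G} {d : Fin n →₀ ℕ} (h : ∀ u ∈ A, (u : Fin n →₀ ℕ) ≤ d) : lcm A ≤ d :=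
  Finset.sup_le h

theorem IsPreserved.mono {A B : Finset G} (hB : IsPreserved r B) (h : A ⊆ B) : IsPreserved r A :=
  fun D hD => hB D (hD.trans h)

theorem exists_forall_not_rel [IsStrictTotalOrder G r] [Finite G] {s : Set G} (hs : s.Nonempty) :
    ∃ q ∈ s, ∀ u ∈ s, ¬ r u q :=
  (Finite.wellFounded_of_trans_of_irrefl r).has_min s hs

open scoped Classical in
/-- Over an antichain, the `L`-admissible symbols are the preserved sets. -/
theorem isAdmissible_iff_isPreserved [IsStrictTotalOrder G r] [Finite G]
    (hG : IsAntichain (· ≤ ·) G) {F : Finset G} : IsAdmissible r F ↔ IsPreserved r F := by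
  constructor
  · rintro h D hD ⟨hne, u, hu, hur⟩
    obtain ⟨a, ha, hmin⟩ := exists_forall_not_rel (r := r) (s := (D : Set G)) hne
    have hsub : D ⊆ F.filter fun c => ¬ r c a := fun c hc =>
      Finset.mem_filter.2 ⟨hD hc, hmin c hc⟩
    by_cases hb : ∃ b ∈ F, r a b
    · exact h a (hD ha) hb u (hur a ha) (hu.trans (lcm_mono hsub))
    -- Admissibility says nothing about the last element of `F`. Here `a` is that element, so `D =
    -- {a}`, and the antichain property excludes a second divisor.
    · push Not at hb
      have hle : lcm D ≤ (a : Fin n →₀ ℕ) := lcm_le fun c hc => by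
        rcases trichotomous_of r c a with h1 | h1 | h1
        · exact absurd h1 (hmin c hc)
        · rw [h1]
        · exact absurd h1 (hb c (hD hc))
      have hua : u = a := Subtype.ext (hG.eq u.2 a.2 (hu.trans hle))
      exact irrefl_of r a (hua ▸ hur a ha)
  · intro h a ha _ q hq hle
    refine h _ (Finset.filter_subset (fun c => ¬ r c a) F)
      ⟨⟨a, Finset.mem_filter.2 ⟨ha, irrefl_of r a⟩⟩, q, hle, fun d hd => ?_⟩
    rcases trichotomous_of r a d with h1 | h1 | h1
    · exact trans_of r hq h1
    · exact h1 ▸ hq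
    · exact absurd h1 (Finset.mem_filter.1 hd).2

theorem exists_eMinimalCover_subset {C : Finset G} {u : G} (h : IsCoverOf C u) :
    ∃ D ⊆ C, D ∈ eMinimalCovers G := by
  obtain ⟨D, hDC, hD⟩ := exists_minimal_le_of_wellFoundedLT (fun D => IsCoverOf D u) C h
  exact ⟨D, hDC, u, hD.prop, fun E hE hc => hD.not_lt hc hE⟩

theorem exists_minimalCover_subset {C : Finset G} {u : G} (h : IsCoverOf C u) :
    ∃ D ⊆ C, D ∈ minimalCovers G :=
  exists_minimal_le_of_wellFoundedLT (fun D : Finset G => ∃ u, IsCoverOf D u) C ⟨u, h⟩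

theorem isLyubeznikClutter_eMinimalCovers_iff :
    IsLyubeznikClutter r (eMinimalCovers G) ↔ ∀ C u, IsCoverOf C u → ¬ IsPreserved r C := by
  constructor
  · intro h C u hC hp
    obtain ⟨D, hDC, hD⟩ := exists_eMinimalCover_subset hC
    exact h D hD (hp.mono hDC)
  · rintro h C ⟨u, hC, -⟩
    exact h C u hC

theorem isLyubeznikClutter_minimalCovers_iff :
    IsLyubeznikClutter r (minimalCovers G) ↔ ∀ C u, IsCoverOf C u → ¬ IsPreserved r C := by
  constructor
  · intro h C u hC hp
    obtain ⟨D, hDC, hD⟩ := exists_minimalCover_subset hC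
    exact h D hD (hp.mono hDC)
  · rintro h C ⟨⟨u, hC⟩, -⟩
    exact h C u hC

/-- Nonemptiness keeps the size of a preserved member apart from the default value 0; finiteness
bounds the supremum. -/
theorem obs_eq_zero_iff [Finite G] {𝒞 : Set (Finset G)} (h𝒞 : ∀ A ∈ 𝒞, A.Nonempty) :
    obs r 𝒞 = 0 ↔ IsLyubeznikClutter r 𝒞 := by
  constructor
  · intro h A hA hp
    have hfin : {k | ∃ A ∈ 𝒞, IsPreserved r A ∧ A.card = k}.Finite := by
      refine (Set.finite_range (fun A : Finset G => A.card)).subset ?_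
      rintro k ⟨A, -, -, rfl⟩
      exact ⟨A, rfl⟩
    have hle : A.card ≤ obs r 𝒞 := le_csSup hfin.bddAbove ⟨A, hA, hp, rfl⟩
    have hpos := (h𝒞 A hA).card_pos
    omega
  · intro h
    have hempty : {k | ∃ A ∈ 𝒞, IsPreserved r A ∧ A.card = k} = ∅ := by
      refine Set.eq_empty_of_forall_notMem ?_
      rintro k ⟨A, hA, hp, -⟩
      exact h A hA hp
    rw [obs, hempty, csSup_empty, bot_eq_zero]

theorem totalObs_eq_zero_iff [Finite G] {𝒞 : Set (Finset G)} (h𝒞 : ∀ A ∈ 𝒞, A.Nonempty) :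
    totalObs 𝒞 = 0 ↔ ∃ r : G → G → Prop, IsStrictTotalOrder G r ∧ IsLyubeznikClutter r 𝒞 := by
  -- Some order exists, so the infimum is attained and is not the default 0 of `sInf ∅`.
  have hne : {k | ∃ r : G → G → Prop, IsStrictTotalOrder G r ∧ obs r 𝒞 = k}.Nonempty :=
    ⟨_, WellOrderingRel, inferInstance, rfl⟩
  constructor
  · intro h
    obtain ⟨r, hr, h0⟩ := Nat.sInf_mem hne
    exact ⟨r, hr, (obs_eq_zero_iff h𝒞).1 (h0.trans h)⟩
  · rintro ⟨r, hr, h⟩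
    exact Nat.sInf_eq_zero.2 (Or.inl ⟨r, hr, (obs_eq_zero_iff h𝒞).2 h⟩)

theorem nonempty_of_mem_eMinimalCovers {A : Finset G} (hA : A ∈ eMinimalCovers G) : A.Nonempty :=
  let ⟨u, hu, _⟩ := hA
  ⟨u, hu.1⟩

theorem nonempty_of_mem_minimalCovers {A : Finset G} (hA : A ∈ minimalCovers G) : A.Nonempty :=
  let ⟨⟨u, hu⟩, _⟩ := hA
  ⟨u, hu.1⟩

/-! ### The first generator dividing a monomial -/

/-- `q` is the first element of `G` dividing the monomial `d`. -/
def IsFirst (r : G → G → Prop) (d : Fin n →₀ ℕ) (q : G) : Prop :=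
  (q : Fin n →₀ ℕ) ≤ d ∧ ∀ u : G, (u : Fin n →₀ ℕ) ≤ d → ¬ r u q

theorem exists_isFirst [IsStrictTotalOrder G r] [Finite G] {d : Fin n →₀ ℕ} {a : G}
    (ha : (a : Fin n →₀ ℕ) ≤ d) : ∃ q, IsFirst r d q :=
  exists_forall_not_rel (r := r) (s := {u : G | (u : Fin n →₀ ℕ) ≤ d}) ⟨a, ha⟩

theorem IsFirst.rel [IsStrictTotalOrder G r] {d : Fin n →₀ ℕ} {q a : G} (hq : IsFirst r d q)
    (ha : (a : Fin n →₀ ℕ) ≤ d) (hne : a ≠ q) : r q a := by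
  rcases trichotomous_of r q a with h | h | h
  · exact h
  · exact absurd h.symm hne
  · exact absurd h (hq.2 a ha)

theorem IsFirst.unique [IsStrictTotalOrder G r] {d : Fin n →₀ ℕ} {q a : G} (hq : IsFirst r d q)
    (ha : IsFirst r d a) : a = q := by
  by_contra hne
  exact ha.2 q hq.1 (hq.rel ha.1 hne)

-- Nothing before `q` divides `d`, so `q` itself imposes no condition; the tail from any later
-- element omits `q` and is a tail of `F`.
open scoped Classical in
theorem IsAdmissible.insert [IsStrictTotalOrder G r] {F : Finset G} (hF : IsAdmissible r F)
    {d : Fin n →₀ ℕ} (hd : lcm F ≤ d) {q : G} (hq : IsFirst r d q) :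
    IsAdmissible r (Insert.insert q F) := by
  have hle : ∀ c ∈ Insert.insert q F, (c : Fin n →₀ ℕ) ≤ d := by
    intro c hc
    rcases Finset.mem_insert.1 hc with rfl | hc
    · exact hq.1
    · exact (le_lcm hc).trans hd
  rintro a ha ⟨b, hb, hab⟩ u hu hul
  by_cases haq : a = q
  · subst haq
    exact hq.2 u (hul.trans (lcm_le fun c hc => hle c (Finset.mem_filter.1 hc).1)) hu
  · have hqa := hq.rel (hle a ha) haq
    have hbq : b ≠ q := by
      rintro rfl
      exact hq.2 a (hle a ha) hab
    refine hF a (Finset.mem_of_mem_insert_of_ne ha haq)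
      ⟨b, Finset.mem_of_mem_insert_of_ne hb hbq, hab⟩ u hu ?_
    rwa [Finset.filter_insert, if_neg (not_not.2 hqa)] at hul

-- With two elements, the least element of `F` is not its last, and the tail from it is all of `F`;
-- admissibility then forbids any earlier divisor of `lcm F`.
open scoped Classical in
theorem IsAdmissible.mem_of_isFirst [IsStrictTotalOrder G r] [Finite G] {F : Finset G}
    (hF : IsAdmissible r F) (hcard : 1 < F.card) {q : G} (hq : IsFirst r (lcm F) q) : q ∈ F := by
  obtain ⟨a, ha, hmin⟩ := exists_forall_not_rel (r := r) (s := (F : Set G))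
    (Finset.card_pos.1 (by omega))
  by_contra hqF
  have hqa := hq.rel (le_lcm ha) (fun h => hqF (h ▸ ha))
  obtain ⟨b, hb, hba⟩ := Finset.exists_mem_ne hcard a
  have hab : r a b := by
    rcases trichotomous_of r a b with h | h | h
    · exact h
    · exact absurd h.symm hba
    · exact absurd h (hmin b hb)
  refine hF a ha ⟨b, hb, hab⟩ q hqa ?_
  rw [Finset.filter_true_of_mem hmin]
  exact hq.1

end Combinatorics

/-! ### The contracting homotopy -/

section Complex

variable {K : Type*} [Field K] {n : ℕ} {G : Set (Fin n →₀ ℕ)} {r : G → G → Prop} {t : ℕ}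

/-- The multiple of the symbol `F` in multidegree `d`, for `d` divisible by `lcm F`. -/
def term (K : Type*) [Field K] (d : Fin n →₀ ℕ) (F : Symbols r t) : L K r t :=
  Finsupp.single F (monomial (d - lcm F.1) (1 : K))

open scoped Classical in
/-- The multiple of the face of `F` opposite to `a` in multidegree `d`. -/
def faceTerm (K : Type*) [Field K] (d : Fin n →₀ ℕ) (F : Symbols r (t + 1)) (a : G) : L K r t :=
  if h : a ∈ F.1 then term K d (F.face a h) else 0

theorem faceTerm_of_mem {d : Fin n →₀ ℕ} {F : Symbols r (t + 1)} {a : G} (h : a ∈ F.1) :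
    faceTerm K d F a = term K d (F.face a h) :=
  dif_pos h

theorem single_monomial (F : Symbols r t) (a : Fin n →₀ ℕ) :
    (Finsupp.single F (monomial a (1 : K)) : L K r t) = term K (a + lcm F.1) F := by
  rw [term, add_tsub_cancel_right]

-- Scaling every symbol up to multidegree `d` absorbs the quotients of lcms, leaving only signs.
open scoped Classical in
theorem differential_term {d : Fin n →₀ ℕ} {F : Symbols r (t + 1)} (hd : lcm F.1 ≤ d) :
    differential K r t (term K d F) =
      ∑ a ∈ F.1, (-1 : ℤ) ^ (F.1.filter fun c => r c a).card • faceTerm K d F a := by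
  rw [differential, term, Finsupp.linearCombination_single, Finset.smul_sum,
    ← Finset.sum_coe_sort F.1]
  refine Finset.sum_congr rfl fun a _ => ?_
  have hle : lcm (F.1.erase a.1) ≤ lcm F.1 := lcm_mono (Finset.erase_subset _ _)
  have hmul : monomial (d - lcm F.1) (1 : K) * monomial (lcm F.1 - lcm (F.1.erase a.1)) 1 =
      monomial (d - lcm (F.1.erase a.1)) 1 := by
    rw [monomial_mul, one_mul, tsub_add_tsub_cancel hd hle]
  rw [faceTerm_of_mem a.2, term, Finsupp.smul_single, Finsupp.smul_single, smul_eq_mul,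
    mul_left_comm, hmul, zsmul_eq_mul]
  push_cast
  rfl

open scoped Classical in
/-- The cone over the symbol `F` in multidegree `d`, with apex the first generator dividing `d`. -/
def cone (K : Type*) [Field K] (d : Fin n →₀ ℕ) (F : Symbols r t) : L K r (t + 1) :=
  if h : ∃ H : Symbols r (t + 1), ∃ q, IsFirst r d q ∧ q ∉ F.1 ∧ H.1 = insert q F.1 then
    term K d h.choose else 0

theorem cone_of_mem [IsStrictTotalOrder G r] {d : Fin n →₀ ℕ} {q : G} (hq : IsFirst r d q)
    {F : Symbols r t} (hF : q ∈ F.1) : cone K d F = 0 := by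
  refine dif_neg ?_
  rintro ⟨H, q', hq', hF', -⟩
  exact hF' (hq.unique hq' ▸ hF)

open scoped Classical in
theorem cone_of_notMem [IsStrictTotalOrder G r] {d : Fin n →₀ ℕ} {q : G} (hq : IsFirst r d q)
    {F : Symbols r t} (hF : q ∉ F.1) {H : Symbols r (t + 1)} (hH : H.1 = insert q F.1) :
    cone K d F = term K d H := by
  have h : ∃ H : Symbols r (t + 1), ∃ q, IsFirst r d q ∧ q ∉ F.1 ∧ H.1 = insert q F.1 :=
    ⟨H, q, hq, hF, hH⟩
  rw [cone, dif_pos h]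
  obtain ⟨q', hq', -, hH'⟩ := h.choose_spec
  congr 1
  exact Subtype.ext (by rw [hH', hH, hq.unique hq'])

/-- The `K`-linear contraction of the complex which, in each multidegree, is the cone operator. -/
def contraction (K : Type*) [Field K] (r : G → G → Prop) (t : ℕ) : L K r t →ₗ[K] L K r (t + 1) :=
  Finsupp.lsum K fun F =>
    (basisMonomials (Fin n) K).constr K fun a => cone K (a + lcm F.1) F

theorem contraction_term {d : Fin n →₀ ℕ} {F : Symbols r t} (hd : lcm F.1 ≤ d) :
    contraction K r t (term K d F) = cone K d F := by
  have h : monomial (d - lcm F.1) (1 : K) = basisMonomials (Fin n) K (d - lcm F.1) := by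
    rw [coe_basisMonomials]
  rw [contraction, term, Finsupp.lsum_single, h, Module.Basis.constr_basis, tsub_add_cancel_of_le hd]

theorem lcm_face_le {d : Fin n →₀ ℕ} {F : Symbols r (t + 1)} (hd : lcm F.1 ≤ d) {a : G}
    (ha : a ∈ F.1) : lcm (F.face a ha).1 ≤ d := by
  classical
  exact (lcm_mono (Finset.erase_subset a F.1)).trans hd

open scoped Classical in
/-- The symbol obtained by adding the first generator dividing a common multiple. -/
def Symbols.insert [IsStrictTotalOrder G r] (F : Symbols r t) {d : Fin n →₀ ℕ} {q : G}
    (hd : lcm F.1 ≤ d) (hq : IsFirst r d q) (hF : q ∉ F.1) : Symbols r (t + 1) :=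
  ⟨Insert.insert q F.1, by rw [Finset.card_insert_of_notMem hF, F.2.1], F.2.2.insert hd hq⟩

open scoped Classical in
theorem filter_rel_isFirst [IsStrictTotalOrder G r] {d : Fin n →₀ ℕ} {q : G} (hq : IsFirst r d q)
    {F : Finset G} (hd : lcm F ≤ d) : (F.filter fun c => r c q) = ∅ :=
  Finset.filter_false_of_mem fun c hc => hq.2 c ((le_lcm hc).trans hd)

open scoped Classical in
theorem lcm_insert_le {d : Fin n →₀ ℕ} {q : G} {F : Finset G} (hd : lcm F ≤ d)
    (hq : (q : Fin n →₀ ℕ) ≤ d) : lcm (insert q F) ≤ d :=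
  lcm_le fun c hc => by
    rcases Finset.mem_insert.1 hc with rfl | hc
    · exact hq
    · exact (le_lcm hc).trans hd

-- As `q` precedes all of `F`, the face opposite `q` has sign `+1` and every other sign flips.
open scoped Classical in
theorem differential_contraction_term [IsStrictTotalOrder G r] {d : Fin n →₀ ℕ} {q : G}
    (hq : IsFirst r d q) {F : Symbols r t} (hd : lcm F.1 ≤ d) (hF : q ∉ F.1) :
    differential K r t (contraction K r t (term K d F)) = term K d F +
      ∑ a ∈ F.1, (-1 : ℤ) ^ ((F.1.filter fun c => r c a).card + 1) •
        faceTerm K d (F.insert hd hq hF) a := by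
  have hd' : lcm (F.insert hd hq hF).1 ≤ d := lcm_insert_le hd hq.1
  have hmem : q ∈ (F.insert hd hq hF).1 := Finset.mem_insert_self q F.1
  have hface : (F.insert hd hq hF).face q hmem = F := Subtype.ext (Finset.erase_insert hF)
  rw [contraction_term hd, cone_of_notMem hq hF (H := F.insert hd hq hF) rfl,
    differential_term hd']
  refine (Finset.sum_insert hF).trans ?_
  congr 1
  · rw [filter_rel_isFirst hq hd', faceTerm_of_mem hmem, hface]
    simp
  · refine Finset.sum_congr rfl fun a ha => ?_
    have hqa : r q a := hq.rel ((le_lcm ha).trans hd) (fun h => hF (h ▸ ha))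
    have hcard : ((F.insert hd hq hF).1.filter fun c => r c a).card =
        (F.1.filter fun c => r c a).card + 1 := by
      rw [Symbols.insert, Finset.filter_insert, if_pos hqa, Finset.card_insert_of_notMem]
      exact fun h => hF (Finset.mem_filter.1 h).1
    rw [hcard]

/-- If `q ∈ F`, the cone kills `F` and all its faces except the one opposite `q`, whose cone is `F`.
If `q ∉ F`, the sign flip cancels the cones of the faces against the faces of the cone. Positive
dimension guarantees that `q` exists. -/
theorem homotopy_term [IsStrictTotalOrder G r] [Finite G] {d : Fin n →₀ ℕ} {F : Symbols r (t + 1)}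
    (hd : lcm F.1 ≤ d) :
    differential K r (t + 1) (contraction K r (t + 1) (term K d F)) +
      contraction K r t (differential K r t (term K d F)) = term K d F := by
  classical
  obtain ⟨a, ha⟩ : F.1.Nonempty := Finset.card_pos.1 (by rw [F.2.1]; omega)
  obtain ⟨q, hq⟩ := exists_isFirst (r := r) ((le_lcm ha).trans hd)
  rw [differential_term hd, map_sum]
  by_cases hF : q ∈ F.1
  · rw [contraction_term hd, cone_of_mem hq hF, map_zero, zero_add, Finset.sum_eq_single q]
    · rw [filter_rel_isFirst hq hd, faceTerm_of_mem hF, map_zsmul,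
        contraction_term (lcm_face_le hd hF),
        cone_of_notMem hq (Finset.notMem_erase q F.1) (Finset.insert_erase hF).symm]
      simp
    · intro b hb hbq
      rw [faceTerm_of_mem hb, map_zsmul, contraction_term (lcm_face_le hd hb),
        cone_of_mem hq (Finset.mem_erase.2 ⟨hbq.symm, hF⟩), smul_zero]
    · exact fun h => absurd hF h
  · rw [differential_contraction_term hq hd hF, add_assoc, ← Finset.sum_add_distrib,
      Finset.sum_eq_zero, add_zero]
    intro b hb
    have hbG : b ∈ (F.insert hd hq hF).1 := Finset.mem_insert_of_mem hb
    have hqb : q ≠ b := fun h => hF (h ▸ hb)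
    have hqF : q ∉ (F.face b hb).1 := fun h => hF (Finset.mem_of_mem_erase h)
    have hface : ((F.insert hd hq hF).face b hbG).1 = insert q (F.face b hb).1 :=
      Finset.erase_insert_of_ne hqb
    rw [faceTerm_of_mem hb, faceTerm_of_mem hbG, map_zsmul, contraction_term (lcm_face_le hd hb),
      cone_of_notMem hq hqF hface,
      pow_succ, ← add_smul]
    simp

/-- Two `K`-linear maps on `Lᵗ` agree if they agree on the homogeneous basis. -/
theorem linearMap_ext_term {M : Type*} [AddCommGroup M] [Module K M] {f g : L K r t →ₗ[K] M}
    (h : ∀ d F, lcm F.1 ≤ d → f (term K d F) = g (term K d F)) : f = g := by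
  refine Finsupp.lhom_ext' fun F => (basisMonomials (Fin n) K).ext fun a => ?_
  rw [coe_basisMonomials]
  change f (Finsupp.single F (monomial a 1)) = g (Finsupp.single F (monomial a 1))
  rw [single_monomial]
  exact h _ F le_add_self

/-- The apex depends on the multidegree, so the contraction is only `K`-linear and scalars are
restricted. -/
theorem homotopy [IsStrictTotalOrder G r] [Finite G] (y : L K r (t + 1)) :
    differential K r (t + 1) (contraction K r (t + 1) y) +
      contraction K r t (differential K r t y) = y := by
  have h : (differential K r (t + 1)).restrictScalars K ∘ₗ contraction K r (t + 1) +
      contraction K r t ∘ₗ (differential K r t).restrictScalars K = LinearMap.id :=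
    linearMap_ext_term fun d F hd => homotopy_term hd
  exact LinearMap.congr_fun h y

/-- In its own multidegree `lcm F`, the symbol contains the apex, so it is the cone over the
opposite face. -/
theorem exists_contraction_eq [IsStrictTotalOrder G r] [Finite G] (F : Symbols r (t + 2)) :
    ∃ y, contraction K r (t + 1) y = Finsupp.single F 1 := by
  classical
  obtain ⟨a, ha⟩ : F.1.Nonempty := Finset.card_pos.1 (by rw [F.2.1]; omega)
  obtain ⟨q, hq⟩ := exists_isFirst (r := r) (le_lcm ha)
  have hF : q ∈ F.1 := F.2.2.mem_of_isFirst (by rw [F.2.1]; omega) hq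
  refine ⟨term K (lcm F.1) (F.face q hF), ?_⟩
  rw [contraction_term (lcm_face_le le_rfl hF),
    cone_of_notMem hq (Finset.notMem_erase q F.1) (Finset.insert_erase hF).symm, term, tsub_self]
  rfl

theorem eq_zero_of_contraction [IsStrictTotalOrder G r] [Finite G] {M : Type*} [AddCommGroup M]
    [Module (MvPolynomial (Fin n) K) M] (f : L K r (t + 2) →ₗ[MvPolynomial (Fin n) K] M)
    (h : ∀ y, f (contraction K r (t + 1) y) = 0) : f = 0 := by
  refine Finsupp.lhom_ext' fun F => LinearMap.ext_ring ?_
  obtain ⟨y, hy⟩ := exists_contraction_eq (K := K) F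
  change f (Finsupp.single F 1) = 0
  rw [← hy, h]

end Complex

section Ideal

/-! ### Exactness for a monomial ideal -/

variable {K : Type*} [Field K] {n : ℕ} {I : Ideal (MvPolynomial (Fin n) K)}
  {r : gens I → gens I → Prop}

theorem isAntichain_gens : IsAntichain (· ≤ ·) (gens I) :=
  setOfPred_minimal_antichain _

theorem exists_gens_le {b : Fin n →₀ ℕ} (hb : monomial b (1 : K) ∈ I) :
    ∃ a : gens I, (a : Fin n →₀ ℕ) ≤ b := by
  obtain ⟨a, hab, ha⟩ :=
    exists_minimal_le_of_wellFoundedLT (fun b => monomial b (1 : K) ∈ I) b hb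
  exact ⟨⟨a, ha⟩, hab⟩

theorem IsMonomialIdeal.monomial_mem (hI : IsMonomialIdeal I) {p : MvPolynomial (Fin n) K}
    (hp : p ∈ I) {a : Fin n →₀ ℕ} (ha : a ∈ p.support) : monomial a (1 : K) ∈ I := by
  obtain ⟨S, rfl⟩ := hI
  rw [mem_ideal_span_monomial_image] at hp ⊢
  intro b hb
  rw [Finset.mem_singleton.1 (support_monomial_subset hb)]
  exact hp a ha

theorem Symbols.eq_empty {G : Set (Fin n →₀ ℕ)} {r : G → G → Prop} (F : Symbols r 0) :
    F = Symbols.empty r :=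
  Subtype.ext (Finset.card_eq_zero.1 F.2.1)

theorem eq_single_empty {G : Set (Fin n →₀ ℕ)} {r : G → G → Prop} (y : L K r 0) :
    y = Finsupp.single (Symbols.empty r) (y (Symbols.empty r)) := by
  ext1 F
  rw [F.eq_empty, Finsupp.single_eq_same]

theorem augmentation_eq (y : L K r 0) :
    augmentation I r y = Ideal.Quotient.mk I (y (Symbols.empty r)) := by
  conv_lhs => rw [eq_single_empty y]
  rw [augmentation, Finsupp.linearCombination_single]
  exact congrArg (Ideal.Quotient.mk I) (mul_one _)

theorem augmentation_differential (y : L K r 1) :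
    augmentation I r (differential K r 0 y) = 0 := by
  classical
  have h : augmentation I r ∘ₗ differential K r 0 = 0 := by
    refine Finsupp.lhom_ext' fun F => LinearMap.ext_ring ?_
    change augmentation I r (differential K r 0 (Finsupp.single F 1)) = 0
    rw [differential, Finsupp.linearCombination_single, one_smul, map_sum]
    refine Finset.sum_eq_zero fun a _ => ?_
    rw [augmentation_eq, Ideal.Quotient.eq_zero_iff_mem, (F.face a.1 a.2).eq_empty,
      Finsupp.single_eq_same]
    obtain ⟨b, hb⟩ := Finset.card_eq_one.1 F.2.1
    have ha : F.1 = {a.1} :=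
      hb.trans (congrArg _ (Finset.mem_singleton.1 (hb ▸ a.2)).symm)
    have hF : lcm F.1 = (a.1 : Fin n →₀ ℕ) := (congrArg lcm ha).trans Finset.sup_singleton
    have he : lcm (F.1.erase a.1) = 0 :=
      congrArg lcm ((congrArg (Finset.erase · a.1) ha).trans (Finset.erase_singleton a.1))
    rw [hF, he, tsub_zero]
    exact I.mul_mem_left _ (Minimal.prop (P := fun b => monomial b (1 : K) ∈ I) a.1.2)
  exact LinearMap.congr_fun h y

/-- In dimension 0 an apex exists only in multidegrees divisible by a generator; all monomials of an
element of `I` have this property. -/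
theorem differential_contraction_of_augmentation [IsStrictTotalOrder (gens I) r]
    (hI : IsMonomialIdeal I) {y : L K r 0} (hy : augmentation I r y = 0) :
    differential K r 0 (contraction K r 0 y) = y := by
  rw [augmentation_eq, Ideal.Quotient.eq_zero_iff_mem] at hy
  have hsum : y = ∑ a ∈ (y (Symbols.empty r)).support,
      coeff a (y (Symbols.empty r)) • term K a (Symbols.empty r) := by
    conv_lhs => rw [eq_single_empty y, (y (Symbols.empty r)).as_sum, Finsupp.single_finsetSum]
    refine Finset.sum_congr rfl fun a _ => ?_
    rw [term, Finsupp.smul_single, smul_monomial, smul_eq_mul, mul_one]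
    exact congrArg (fun b => Finsupp.single (Symbols.empty r)
      (monomial b (coeff a (y (Symbols.empty r))))) (tsub_zero a).symm
  -- Decouples the coefficients from `y`, so that expanding `y` does not rewrite inside its own
  -- expansion.
  generalize (y (Symbols.empty r)) = p at hy hsum
  rw [hsum, map_sum, map_sum]
  refine Finset.sum_congr rfl fun a ha => ?_
  obtain ⟨b, hb⟩ := exists_gens_le (hI.monomial_mem hy ha)
  obtain ⟨q, hq⟩ := exists_isFirst (r := r) hb
  have hd : lcm (Symbols.empty r).1 ≤ a := bot_le (a := a)
  have hF : q ∉ (Symbols.empty r).1 := Finset.notMem_empty q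
  rw [map_smul, LinearMap.map_smul_of_tower, differential_contraction_term hq hd hF]
  congr 1
  exact add_eq_left.2 Finset.sum_empty

/-- With `s` the contraction, `∂ ∂ s = ∂ - ∂ s ∂`, and `∂ s ∂ = ∂` by the homotopy one dimension
lower and the inductive hypothesis. The augmentation plays that role at the bottom. -/
theorem differential_differential [IsStrictTotalOrder (gens I) r] (hI : IsMonomialIdeal I) (t : ℕ) :
    differential K r t ∘ₗ differential K r (t + 1) = 0 := by
  induction t with
  | zero =>
    refine eq_zero_of_contraction _ fun y => ?_
    rw [LinearMap.comp_apply, eq_sub_of_add_eq (homotopy y), map_sub,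
      differential_contraction_of_augmentation hI (augmentation_differential y), sub_self]
  | succ t ih =>
    refine eq_zero_of_contraction _ fun y => ?_
    have h := homotopy (differential K r (t + 1) y)
    rw [← LinearMap.comp_apply (differential K r t), ih, LinearMap.zero_apply, map_zero,
      add_zero] at h
    rw [LinearMap.comp_apply, eq_sub_of_add_eq (homotopy y), map_sub, h, sub_self]

theorem exact_differential [IsStrictTotalOrder (gens I) r] (hI : IsMonomialIdeal I) (t : ℕ) :
    Function.Exact (differential K r (t + 1)) (differential K r t) := by
  intro y
  constructor
  · intro h
    refine ⟨contraction K r (t + 1) y, ?_⟩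
    have := homotopy y
    rwa [h, map_zero, add_zero] at this
  · rintro ⟨z, rfl⟩
    exact LinearMap.congr_fun (differential_differential hI t) z

theorem exact_augmentation [IsStrictTotalOrder (gens I) r] (hI : IsMonomialIdeal I) :
    Function.Exact (differential K r 0) (augmentation I r) := by
  intro y
  constructor
  · exact fun h => ⟨contraction K r 0 y, differential_contraction_of_augmentation hI h⟩
  · rintro ⟨z, rfl⟩
    exact augmentation_differential z

theorem augmentation_surjective : Function.Surjective (augmentation I r) := by
  intro x
  obtain ⟨p, rfl⟩ := Ideal.Quotient.mk_surjective x
  exact ⟨Finsupp.single (Symbols.empty r) p, by rw [augmentation_eq, Finsupp.single_eq_same]⟩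

end Ideal

/-! ### Minimality and covers -/

section Minimal

variable {K : Type*} [Field K] {n : ℕ} {G : Set (Fin n →₀ ℕ)} {r : G → G → Prop} {t : ℕ}

theorem constantCoeff_eq_zero_of_mem_smul_top {ι : Type*} {y : ι →₀ MvPolynomial (Fin n) K}
    (hy : y ∈ Ideal.span (Set.range (X : Fin n → MvPolynomial (Fin n) K)) •
      (⊤ : Submodule (MvPolynomial (Fin n) K) (ι →₀ MvPolynomial (Fin n) K))) (i : ι) :
    constantCoeff (y i) = 0 := by
  have hle : Ideal.span (Set.range (X : Fin n → MvPolynomial (Fin n) K)) ≤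
      RingHom.ker (constantCoeff (R := K) (σ := Fin n)) := by
    rw [Ideal.span_le]
    rintro _ ⟨j, rfl⟩
    exact constantCoeff_X K j
  induction hy using Submodule.smul_induction_on' with
  | smul p hp z _ =>
    rw [Finsupp.smul_apply, smul_eq_mul, map_mul, (RingHom.mem_ker).1 (hle hp), zero_mul]
  | add y _ z _ hy hz => rw [Finsupp.add_apply, map_add, hy, hz, add_zero]

theorem monomial_mem_span_X {e : Fin n →₀ ℕ} (he : e ≠ 0) :
    monomial e (1 : K) ∈ Ideal.span (Set.range (X : Fin n → MvPolynomial (Fin n) K)) := by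
  rw [← Set.image_univ, mem_ideal_span_X_image]
  intro m hm
  rw [Finset.mem_singleton.1 (support_monomial_subset hm)]
  obtain ⟨i, hi⟩ := Finsupp.ne_iff.1 he
  exact ⟨i, Set.mem_univ i, hi⟩

open scoped Classical in
theorem lcm_sub_lcm_erase_eq_zero_iff {F : Finset G} {a : G} (ha : a ∈ F) :
    lcm F - lcm (F.erase a) = 0 ↔ IsCoverOf F a := by
  rw [tsub_eq_zero_iff_le, IsCoverOf]
  constructor
  · exact fun h => ⟨ha, (le_lcm ha).trans h⟩
  · rintro ⟨-, h⟩
    rw [← Finset.insert_erase ha]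
    refine lcm_insert_le ?_ ?_ <;> rw [Finset.insert_erase ha]
    exact h

/-- The differential is minimal in degree `t + 1` iff no symbol of dimension `t + 1` is a cover. -/
theorem range_differential_le_iff :
    LinearMap.range (differential K r t) ≤
        Ideal.span (Set.range (X : Fin n → MvPolynomial (Fin n) K)) •
          (⊤ : Submodule (MvPolynomial (Fin n) K) (L K r t)) ↔
      ∀ (F : Symbols r (t + 1)) (a : G), ¬ IsCoverOf F.1 a := by
  classical
  constructor
  · intro h F a hFa
    have hmem := constantCoeff_eq_zero_of_mem_smul_top
      (h ⟨Finsupp.single F 1, rfl⟩) (F.face a hFa.1)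
    rw [differential, Finsupp.linearCombination_single, one_smul, Finsupp.finsetSum_apply,
      Finset.sum_eq_single ⟨a, hFa.1⟩, Finsupp.single_eq_same,
      (lcm_sub_lcm_erase_eq_zero_iff hFa.1).2 hFa] at hmem
    · simp at hmem
    · intro b _ hb
      -- Distinct elements give distinct faces, so no other summand can cancel the unit coefficient
      -- at this face.
      refine Finsupp.single_eq_of_ne fun he => hb ?_
      have he' : F.1.erase a = F.1.erase b.1 := congrArg Subtype.val he
      by_contra hne
      have : b.1 ∈ F.1.erase a :=
        Finset.mem_erase.2 ⟨fun hba => hne (Subtype.ext hba), b.2⟩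
      rw [he'] at this
      exact Finset.notMem_erase _ _ this
    · exact fun h => absurd (Finset.mem_univ _) h
  · intro h
    rw [differential, Finsupp.range_linearCombination, Submodule.span_le]
    rintro _ ⟨F, rfl⟩
    refine Submodule.sum_mem _ fun a _ => ?_
    have hm := monomial_mem_span_X (K := K)
      (mt (lcm_sub_lcm_erase_eq_zero_iff a.2).1 (h F a.1))
    have := Submodule.smul_mem_smul hm (Submodule.mem_top
      (x := (Finsupp.single (F.face a.1 a.2)
        ((-1) ^ (F.1.filter fun c => r c a.1).card) : L K r t)))
    rwa [Finsupp.smul_single, smul_eq_mul, mul_comm] at this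

instance [Finite G] : Finite (Symbols r t) :=
  inferInstanceAs (Finite {F : Finset G // F.card = t ∧ IsAdmissible r F})

/-- Freeness, finiteness and exactness are automatic; only the minimality field depends on covers.
-/
theorem hasMinimalResolution_iff {I : Ideal (MvPolynomial (Fin n) K)} (hI : IsMonomialIdeal I)
    (r : gens I → gens I → Prop) [IsStrictTotalOrder (gens I) r] :
    HasMinimalResolution I r ↔ ∀ C u, IsCoverOf C u → ¬ IsPreserved r C := by
  constructor
  · intro h C u hC hp
    have hcard : C.card = C.card - 1 + 1 := by
      have := Finset.card_pos.2 ⟨u, hC.1⟩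
      omega
    exact range_differential_le_iff.1 (h.minimal (C.card - 1))
      ⟨C, hcard, (isAdmissible_iff_isPreserved isAntichain_gens).2 hp⟩ u hC
  · intro h
    exact
      { free := fun t => inferInstance
        finite := fun t => inferInstance
        surjective := augmentation_surjective
        exact_zero := exact_augmentation hI
        exact_succ := exact_differential hI
        minimal := fun t => range_differential_le_iff.2 fun F a hFa =>
          h F.1 a hFa ((isAdmissible_iff_isPreserved isAntichain_gens).1 F.2.2) }

end Minimal

end Lyubeznik

end

theorem mainTheorem6 {K : Type*} [Field K] {n : ℕ} (I : Ideal (MvPolynomial (Fin n) K))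
    (hI : Lyubeznik.IsMonomialIdeal I) :
    -- the criteria for the family of `E`-minimal covers
    (Lyubeznik.IsLyubeznikIdeal I ↔ Lyubeznik.TObsL I = 0) ∧
    (Lyubeznik.IsLyubeznikIdeal I ↔
      ∃ r : Lyubeznik.gens I → Lyubeznik.gens I → Prop,
        IsStrictTotalOrder (Lyubeznik.gens I) r ∧
          Lyubeznik.IsLyubeznikClutter r (Lyubeznik.eMinimalCovers (Lyubeznik.gens I))) ∧
    (∀ r : Lyubeznik.gens I → Lyubeznik.gens I → Prop, IsStrictTotalOrder (Lyubeznik.gens I) r →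
      (Lyubeznik.HasMinimalResolution I r ↔
        Lyubeznik.IsLyubeznikClutter r (Lyubeznik.eMinimalCovers (Lyubeznik.gens I)))) ∧
    -- the same for the clutter of inclusion-minimal covers
    IsAntichain (· ⊆ ·) (Lyubeznik.minimalCovers (Lyubeznik.gens I)) ∧
    (Lyubeznik.IsLyubeznikIdeal I ↔
      Lyubeznik.totalObs (Lyubeznik.minimalCovers (Lyubeznik.gens I)) = 0) ∧
    (Lyubeznik.IsLyubeznikIdeal I ↔
      ∃ r : Lyubeznik.gens I → Lyubeznik.gens I → Prop,
        IsStrictTotalOrder (Lyubeznik.gens I) r ∧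
          Lyubeznik.IsLyubeznikClutter r (Lyubeznik.minimalCovers (Lyubeznik.gens I))) ∧
    (∀ r : Lyubeznik.gens I → Lyubeznik.gens I → Prop, IsStrictTotalOrder (Lyubeznik.gens I) r →
      (Lyubeznik.HasMinimalResolution I r ↔
        Lyubeznik.IsLyubeznikClutter r (Lyubeznik.minimalCovers (Lyubeznik.gens I)))) := by

  have hE : ∀ r : Lyubeznik.gens I → Lyubeznik.gens I → Prop,
      IsStrictTotalOrder (Lyubeznik.gens I) r → (Lyubeznik.HasMinimalResolution I r ↔
        Lyubeznik.IsLyubeznikClutter r (Lyubeznik.eMinimalCovers (Lyubeznik.gens I))) :=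
    fun r _ => (Lyubeznik.hasMinimalResolution_iff hI r).trans
      Lyubeznik.isLyubeznikClutter_eMinimalCovers_iff.symm
  have hM : ∀ r : Lyubeznik.gens I → Lyubeznik.gens I → Prop,
      IsStrictTotalOrder (Lyubeznik.gens I) r → (Lyubeznik.HasMinimalResolution I r ↔
        Lyubeznik.IsLyubeznikClutter r (Lyubeznik.minimalCovers (Lyubeznik.gens I))) :=
    fun r _ => (Lyubeznik.hasMinimalResolution_iff hI r).trans
      Lyubeznik.isLyubeznikClutter_minimalCovers_iff.symm
  have hE' := exists_congr fun r => and_congr_right (hE r)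
  have hM' := exists_congr fun r => and_congr_right (hM r)
  exact ⟨hE'.trans (Lyubeznik.totalObs_eq_zero_iff fun _ =>
      Lyubeznik.nonempty_of_mem_eMinimalCovers).symm, hE', hE,
    setOfPred_minimal_antichain _, hM'.trans (Lyubeznik.totalObs_eq_zero_iff fun _ =>
      Lyubeznik.nonempty_of_mem_minimalCovers).symm, hM', hM⟩
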